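/- \textbf{Setting.} Let $M$ be a compact connected smooth manifold (without boundary) with $\dim M\ge 3$ and let $\rho$ be a smooth Riemannian metric on $M$. Let $H_1(M;\mathbb Z)_{\mathbb R}$ be the group of integer classes in $H_1(M;\mathbb R)$ (the image of $H_1(M;\mathbb Z)$), and let $p:\bar M\to M$ be the abelian covering: the connected covering with deck transformation group $H_1(M;\mathbb Z)_{\mathbb R}$, where the deck transformation $x\mapsto x+v$ sends $x$ to the endpoint of the lifts starting at $x$ of the loops of class $v$. An integer class $v$ is indivisible if $v=kv'$ with $k\in\mathbb Z$ and $v'$ an integer class implies $k=\pm1$. Let $P\subset H_1(M;\mathbb R)$ be a centrally symmetric convex polytope with nonempty interior whose vertices $\pm\tilde v_1,\dots,\pm\tilde v_N$ have rational directions, and let $v_j=\varepsilon_j\tilde v_j$, $\varepsilon_j>0$, be the corresponding indivisible integer classes. For each nonempty proper face $S$ of $P$, let $J_S\subset\{\pm v_1,\dots,\pm v_N\}$ be the set of the indivisible classes corresponding to the vertices of $P$ in $S$, and let $\lambda_S\in H^1_{dR}(M)\cong \operatorname{Hom}(H_1(M;\mathbb R),\mathbb R)$ be a class which equals $1$ on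 the vertices of $P$ lying in $S$ and is $<1$ on all other vertices of $P$. A Riemannian metric $g$ on $M$ is a \emph{Hedlund metric} associated to $P$ on $(M,\rho)$ if it is conformal to $\rho$ and the following data exist. There are disjoint smooth regular simple closed curves $\gamma_1,\dots,\gamma_N:\mathbb R/\mathbb Z\to M$, parametrized proportionally to $\rho$-arc length, with $\gamma_j$ representing $v_j$; write $\Gamma_j$ for the image of $\gamma_j$. There are radii $0<\varepsilon<\varrho$ such that, for each $j$, the normal exponential map of $\rho$ along $\Gamma_j$ is a diffeomorphism from the bundle of normal balls of radius $\varrho$ onto an open tubular neighborhood $U_\varrho(\Gamma_j)$, and such that the smaller tubular neighborhoods $U_\varepsilon(\Gamma_1),\dots,U_\varepsilon(\Gamma_N)$ are pairwise disjoint. Let $s_j:U_\varrho(\Gamma_j)\to\mathbb R/\mathbb Z$ be the map such that $\gamma_j(s_j(x))$ is the foot point of $x$. For each nonempty proper face $S$ there is a smooth closed $1$-form $\eta_S$ representing $\lambda_S$ with $\eta_S=\lambda_S(v_j)\,ds_j$ on $U_\varepsilon(\Gamma_j)$ for all $j$. Finally, the dual metric $g^*$ satisfies: \begin{enumerate} \item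 for all $j$, $g^*(ds_j,ds_j)=1/\varepsilon_j^2$ on $\Gamma_j$ and $g^*(ds_j,ds_j)<1/\varepsilon_j^2$ on $U_\varepsilon(\Gamma_j)\setminus\Gamma_j$; \item for all nonempty proper faces $S$, $g^*(\eta_S,\eta_S)\le 1$ outside $\bigcup_jU_\varepsilon(\Gamma_j)$. \end{enumerate} \textbf{Lemma.} Let $g$ be a Hedlund metric associated to $P$ on $(M,\rho)$, and let $\bar d$ be the distance on $\bar M$ induced by $p^*g$. Then there is a constant $C$, depending only on the polytope $P$ and the Riemannian manifold $(M,g)$, such that for every nonempty proper face $S$ of $P$, every $w\in\sum_{v\in J_S}\mathbb N\cdot v$ (with $0\in\mathbb N$) and every $x\in\bar M$, $$\bar d(x,x+w)\le\lambda_S(w)+C .$$ -/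

import Mathlib

open scoped Manifold ContDiff Topology ENNReal Simplicial

universe u v

noncomputable section

namespace Hedlund

/-! ### First homology and integer classes -/

section Homology

open CategoryTheory AlgebraicTopology

/-- The coefficient module `ℝ` for singular homology (lifted to the universe of the space). -/
abbrev realCoeff : ModuleCat.{u} ℝ := ModuleCat.of ℝ (ULift.{u} ℝ)

/-- The singular chain complex of `M` with real coefficients. -/
abbrev singularChains (M : Type u) [TopologicalSpace M] : ChainComplex (ModuleCat.{u} ℝ) ℕ :=
  ((singularChainComplexFunctor (ModuleCat.{u} ℝ)).obj realCoeff).obj (TopCat.of M)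

/-- The first singular homology `H₁(M; ℝ)`. -/
def H1 (M : Type u) [TopologicalSpace M] : Type u :=
  ((singularHomologyFunctor (ModuleCat.{u} ℝ) 1).obj realCoeff).obj (TopCat.of M)

instance (M : Type u) [TopologicalSpace M] : AddCommGroup (H1 M) :=
  inferInstanceAs (AddCommGroup
    (((singularHomologyFunctor (ModuleCat.{u} ℝ) 1).obj realCoeff).obj (TopCat.of M)))

instance (M : Type u) [TopologicalSpace M] : Module ℝ (H1 M) :=
  inferInstanceAs (Module ℝ
    (((singularHomologyFunctor (ModuleCat.{u} ℝ) 1).obj realCoeff).obj (TopCat.of M)))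

/-- `H₁(M; ℝ)` carries the canonical vector space topology (for a finite-dimensional real vector
space the module topology is the usual Euclidean one). -/
instance (M : Type u) [TopologicalSpace M] : TopologicalSpace (H1 M) :=
  moduleTopology ℝ (H1 M)

variable (M : Type u) [TopologicalSpace M]

/-- The space of real singular `1`-cycles of `M`. -/
abbrev Cycles1 : Type u := (singularChains M).cycles 1

/-- The inclusion of `1`-cycles into `1`-chains. -/
def cycleChain : Cycles1 M →ₗ[ℝ] (singularChains M).X 1 := ((singularChains M).iCycles 1).hom

/-- The homology class of a `1`-cycle. -/
def cycleClass : Cycles1 M →ₗ[ℝ] H1 M := ((singularChains M).homologyπ 1).hom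

variable {M}

/-- The singular `1`-simplex (with coefficient `1`), as a chain, of a map `σ : Δ¹ → M`. -/
def simplexChain (σ : C(stdSimplex ℝ (Fin 2), M)) : (singularChains M).X 1 :=
  ((TopCat.toSSet.obj (TopCat.of M)).ιChainComplex (R := realCoeff.{u}) (n := 1)
    (((TopCat.of M).toSSetObjEquiv (Opposite.op ⦋1⦌)).symm σ)).hom (ULift.up 1)

/-- A path `c : [0,1] → M` viewed as a singular `1`-chain. -/
def pathChain (c : C(unitInterval, M)) : (singularChains M).X 1 :=
  simplexChain (c.comp ⟨stdSimplexHomeomorphUnitInterval,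
    stdSimplexHomeomorphUnitInterval.continuous⟩)

/-- The map `c : [0,1] → M` is a (continuous) closed curve and its homology class in
`H₁(M; ℝ)` is `h`. -/
def HasClass (c : unitInterval → M) (h : H1 M) : Prop :=
  ∃ hc : Continuous c, c 0 = c 1 ∧
    ∃ z : Cycles1 M, cycleChain M z = pathChain ⟨c, hc⟩ ∧ cycleClass M z = h

variable (M) in
/-- The group `H₁(M; ℤ)_ℝ` of integer classes: the classes in `H₁(M; ℝ)` of the cycles which are
integer combinations of singular simplices, i.e. the image of `H₁(M; ℤ)` in `H₁(M; ℝ)`. -/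
def integerClasses : AddSubgroup (H1 M) :=
  ((AddSubgroup.closure (Set.range (simplexChain (M := M)))).comap
    (cycleChain M).toAddMonoidHom).map (cycleClass M).toAddMonoidHom

/-- An integer class `v` is indivisible if `v = k • v'` with `k ∈ ℤ` and `v'` an integer class
forces `k = ±1`. -/
def IsIndivisible (v : integerClasses M) : Prop :=
  ∀ (k : ℤ) (v' : integerClasses M), v = k • v' → k = 1 ∨ k = -1

end Homology

/-! ### Polytopes in `H₁(M; ℝ)` -/

section Polytope

variable {M : Type u} [TopologicalSpace M]

/-- Admissible polytopes: centrally symmetric convex polytopes with nonempty interior whose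
vertices have rational directions. -/
structure IsAdmissiblePolytope (P : Set (H1 M)) : Prop where
  polytope : ∃ s : Set (H1 M), s.Finite ∧ P = convexHull ℝ s
  symmetric : ∀ x ∈ P, -x ∈ P
  interior_nonempty : (interior P).Nonempty
  rational : ∀ x ∈ P.extremePoints ℝ, ∃ a : ℝ, 0 < a ∧ a • x ∈ integerClasses M

/-- (Nonempty, proper) faces of a polytope: convex extreme subsets. -/
def IsFace (P S : Set (H1 M)) : Prop :=
  IsExtreme ℝ P S ∧ Convex ℝ S ∧ S.Nonempty ∧ S ≠ P

/-- `l` is equal to `1` on the vertices of `P` lying in the face `S` and less than `1` on all the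
other vertices of `P`. -/
def IsFaceFunctional (P S : Set (H1 M)) (l : H1 M →ₗ[ℝ] ℝ) : Prop :=
  ∀ x ∈ P.extremePoints ℝ, (x ∈ S → l x = 1) ∧ (x ∉ S → l x < 1)

/-- An enumeration `±ṽ₁, …, ±ṽ_N` of the `2N` vertices of `P`, with the indivisible integer
classes `vᵢ = εᵢ ṽᵢ`, `εᵢ > 0`. -/
structure VertexClasses (P : Set (H1 M)) (N : ℕ) where
  /-- the vertices `ṽᵢ` -/
  vtx : Fin N → H1 M
  /-- the classes `vᵢ` -/
  cls : Fin N → integerClasses M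
  /-- the factors `εᵢ` -/
  eps : Fin N → ℝ
  extremePoints_eq : P.extremePoints ℝ = Set.range vtx ∪ Set.range (fun i => -vtx i)
  vtx_injective : Function.Injective vtx
  vtx_ne_neg : ∀ i j, vtx i ≠ -vtx j
  eps_pos : ∀ i, 0 < eps i
  cls_eq : ∀ i, (cls i : H1 M) = eps i • vtx i
  indivisible : ∀ i, IsIndivisible (cls i)

/-- The set `J_S ⊆ {±v₁, …, ±v_N}` of the indivisible integer classes which correspond to the
vertices of `P` in the face `S`. -/
def VertexClasses.inFace {P : Set (H1 M)} {N : ℕ} (V : VertexClasses P N) (S : Set (H1 M)) :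
    Set (integerClasses M) :=
  {w | ∃ i, (V.vtx i ∈ S ∧ w = V.cls i) ∨ (-V.vtx i ∈ S ∧ w = -V.cls i)}

end Polytope

/-! ### Riemannian metrics, geodesics, one-forms -/

section Geometry

variable {n : ℕ} {M : Type u} [TopologicalSpace M] [ChartedSpace (EuclideanSpace ℝ (Fin n)) M]

variable (n M) in
/-- Smooth Riemannian metrics on the `n`-manifold `M`. -/
abbrev Metric [IsManifold (𝓡 n) ∞ M] : Type u :=
  Bundle.ContMDiffRiemannianMetric (𝓡 n) ∞ (EuclideanSpace ℝ (Fin n))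
    (fun x : M => TangentSpace (𝓡 n) x)

variable (n M) in
/-- (Not necessarily smooth) `1`-forms on `M`. -/
abbrev OneForm : Type u := (x : M) → (TangentSpace (𝓡 n) x →L[ℝ] ℝ)

/-- The velocity vector of a curve. -/
def velocity (c : ℝ → M) (t : ℝ) : TangentSpace (𝓡 n) (c t) :=
  mfderiv 𝓘(ℝ, ℝ) (𝓡 n) c t (1 : ℝ)

/-- The differential at `y` of the inverse of the chart at `x₀`. -/
def chartInvDeriv (x₀ : M) (y : EuclideanSpace ℝ (Fin n)) :
    EuclideanSpace ℝ (Fin n) →L[ℝ] TangentSpace (𝓡 n) ((extChartAt (𝓡 n) x₀).symm y) :=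
  mfderiv 𝓘(ℝ, EuclideanSpace ℝ (Fin n)) (𝓡 n) (extChartAt (𝓡 n) x₀).symm y

section Metric

variable [IsManifold (𝓡 n) ∞ M]

/-- The coefficients `G_y(a, b)` of the metric in the chart at `x₀`. -/
def chartMetric (ρ : Metric n M) (x₀ : M) (y a b : EuclideanSpace ℝ (Fin n)) : ℝ :=
  ρ.inner ((extChartAt (𝓡 n) x₀).symm y) (chartInvDeriv x₀ y a) (chartInvDeriv x₀ y b)

/-- Geodesics `c : ℝ → M` of `ρ`. In the chart at `c t`, with coordinates `q` and metric
coefficients `G`, the geodesic equation is written in the (Euler-Lagrange) form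
`d/dτ (G_{q}(q', w)) = ½ (∂_w G)_{q}(q', q')` for all constant vectors `w`. -/
def IsGeodesic (ρ : Metric n M) (c : ℝ → M) : Prop :=
  ContMDiff 𝓘(ℝ, ℝ) (𝓡 n) ∞ c ∧
  ∀ t : ℝ, ∀ q : ℝ → EuclideanSpace ℝ (Fin n), q = (fun τ => extChartAt (𝓡 n) (c t) (c τ)) →
    ∀ w : EuclideanSpace ℝ (Fin n),
      HasDerivAt (fun τ => chartMetric ρ (c t) (q τ) (deriv q τ) w)
        (1 / 2 * fderiv ℝ (fun y => chartMetric ρ (c t) y (deriv q t) (deriv q t)) (q t) w) t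

/-- `y` is the value of the exponential map of `ρ` at the tangent vector `ξ`. -/
def IsExp (ρ : Metric n M) (ξ : TangentBundle (𝓡 n) M) (y : M) : Prop :=
  ∃ c : ℝ → M, IsGeodesic ρ c ∧ (⟨c 0, velocity c 0⟩ : TangentBundle (𝓡 n) M) = ξ ∧ c 1 = y

/-- The square `g*ₓ(α, α)` of the dual norm of a covector. -/
def dualSq (g : Metric n M) (x : M) (α : TangentSpace (𝓡 n) x →L[ℝ] ℝ) : ℝ :=
  sSup {a | ∃ X : TangentSpace (𝓡 n) x, g.inner x X X ≤ 1 ∧ a = (α X) ^ 2}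

/-- `g` is (pointwise, with a smooth factor) conformal to `ρ`. -/
def IsConformal (ρ g : Metric n M) : Prop :=
  ∃ f : M → ℝ, ContMDiff (𝓡 n) 𝓘(ℝ, ℝ) ∞ f ∧ (∀ x, 0 < f x) ∧
    ∀ x (X Y : TangentSpace (𝓡 n) x), g.inner x X Y = f x * ρ.inner x X Y

/-! ### Loops and tubular neighborhoods -/

/-- Admissible loops: regular simple closed curves, as `1`-periodic maps on `ℝ`, parametrized
proportionally to arc length. -/
structure IsAdmissibleLoop (ρ : Metric n M) (γ : ℝ → M) : Prop where
  smooth : ContMDiff 𝓘(ℝ, ℝ) (𝓡 n) ∞ γ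
  periodic : Function.Periodic γ 1
  simple : ∀ s t, γ s = γ t → ∃ k : ℤ, s = t + k
  regular : ∀ t, velocity (n := n) γ t ≠ 0
  constant_speed : ∀ s t, ρ.inner (γ s) (velocity γ s) (velocity γ s) =
    ρ.inner (γ t) (velocity γ t) (velocity γ t)

/-- The bundle of open balls of radius `r` in the normal bundle of the curve `γ`, as a subset of
the tangent bundle. -/
def normalBalls (ρ : Metric n M) (γ : ℝ → M) (r : ℝ) : Set (TangentBundle (𝓡 n) M) :=
  {ξ | ∃ (t : ℝ) (X : TangentSpace (𝓡 n) (γ t)),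
    ρ.inner (γ t) X (velocity γ t) = 0 ∧ ρ.inner (γ t) X X < r ^ 2 ∧ ξ = ⟨γ t, X⟩}

/-- The image of the bundle of normal balls of radius `r` under the exponential map. -/
def tube (ρ : Metric n M) (γ : ℝ → M) (r : ℝ) : Set M :=
  {x | ∃ ξ ∈ normalBalls ρ γ r, IsExp ρ ξ x}

/-- The normal exponential map is a diffeomorphism from the bundle of normal balls of radius `r`
onto the open subset `tube ρ γ r`, with inverse `F`: the `r`-tube is a tubular neighborhood. -/
structure IsTubular (ρ : Metric n M) (γ : ℝ → M) (r : ℝ) (F : M → TangentBundle (𝓡 n) M) :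
    Prop where
  pos : 0 < r
  exists_exp : ∀ ξ ∈ normalBalls ρ γ r, ∃ x, IsExp ρ ξ x
  isOpen : IsOpen (tube ρ γ r)
  smooth : ContMDiffOn (𝓡 n) (𝓡 n).tangent ∞ F (tube ρ γ r)
  inverse : ∀ ξ ∈ normalBalls ρ γ r, ∀ x, IsExp ρ ξ x → F x = ξ

/-- `ds` is, on `U`, the differential of the map `s : U → ℝ/ℤ` such that `γ (s x)` is the foot
point `(F x).proj` of `x`; it is computed through local real-valued lifts of `s`. -/
def IsFootDifferential (γ : ℝ → M) (F : M → TangentBundle (𝓡 n) M) (U : Set M)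
    (ds : OneForm n M) : Prop :=
  ∀ x ∈ U, ∃ s : M → ℝ, ContMDiffAt (𝓡 n) 𝓘(ℝ, ℝ) ∞ s x ∧
    (∀ᶠ y in 𝓝 x, γ (s y) = (F y).proj) ∧ HasMFDerivAt (𝓡 n) 𝓘(ℝ, ℝ) s x (ds x)

end Metric

/-! ### De Rham classes -/

/-- The expression of a `1`-form in the chart at `x₀`. -/
def chartForm (η : OneForm n M) (x₀ : M) (y : EuclideanSpace ℝ (Fin n)) :
    EuclideanSpace ℝ (Fin n) →L[ℝ] ℝ :=
  (η ((extChartAt (𝓡 n) x₀).symm y)).comp (chartInvDeriv x₀ y)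

/-- Smooth `1`-forms: smooth sections of the cotangent bundle. -/
def IsSmoothForm [IsManifold (𝓡 n) ∞ M] (η : OneForm n M) : Prop :=
  ContMDiff (𝓡 n) ((𝓡 n).prod 𝓘(ℝ, EuclideanSpace ℝ (Fin n) →L[ℝ] ℝ)) ∞
    (fun x => Bundle.TotalSpace.mk' (EuclideanSpace ℝ (Fin n) →L[ℝ] ℝ)
      (E := fun x : M => TangentSpace (𝓡 n) x →L[ℝ] Bundle.Trivial M ℝ x) x (η x))

/-- Closed `1`-forms: `dη = 0` in the charts. -/
def IsClosedForm (η : OneForm n M) : Prop :=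
  ∀ x₀ : M, ∀ y ∈ (extChartAt (𝓡 n) x₀).target,
    extDeriv (fun z => ContinuousAlternatingMap.ofSubsingleton ℝ (EuclideanSpace ℝ (Fin n)) ℝ
      (0 : Fin 1) (chartForm η x₀ z)) y = 0

/-- The smooth closed `1`-form `η` represents the class `l` in `H¹_dR(M) ≅ Hom(H₁(M; ℝ), ℝ)`: its
integral over each `C¹` closed curve is the value of `l` at the class of the curve. -/
def Represents [IsManifold (𝓡 n) ∞ M] (η : OneForm n M) (l : H1 M →ₗ[ℝ] ℝ) : Prop :=
  IsSmoothForm η ∧ IsClosedForm η ∧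
  ∀ (c : ℝ → M) (h : H1 M), ContMDiff 𝓘(ℝ, ℝ) (𝓡 n) 1 c →
    HasClass (fun t : unitInterval => c t) h → ∫ t in (0 : ℝ)..1, η (c t) (velocity c t) = l h

/-! ### Hedlund metrics -/

variable [IsManifold (𝓡 n) ∞ M]

/-- `g` is a Hedlund metric on `(M, ρ)` associated to the polytope `P`, whose vertices and
corresponding indivisible integer classes are enumerated by `V`, and to the functionals `lam S` of
the faces `S` of `P`. -/
def IsHedlundMetric (ρ : Metric n M) {P : Set (H1 M)} {N : ℕ} (V : VertexClasses P N)
    (lam : Set (H1 M) → (H1 M →ₗ[ℝ] ℝ)) (g : Metric n M) : Prop :=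
  IsConformal ρ g ∧
  ∃ (γ : Fin N → ℝ → M) (R r : ℝ) (F : Fin N → M → TangentBundle (𝓡 n) M)
    (ds : Fin N → OneForm n M) (η : Set (H1 M) → OneForm n M),
    -- disjoint admissible curves in the given classes
    (∀ i, IsAdmissibleLoop ρ (γ i)) ∧
    (∀ i, HasClass (fun t : unitInterval => γ i t) (V.cls i)) ∧
    (∀ i j, i ≠ j → Disjoint (Set.range (γ i)) (Set.range (γ j))) ∧
    -- tubular neighborhoods of radius `R`, which are disjoint for the smaller radius `r`
    (∀ i, IsTubular ρ (γ i) R (F i)) ∧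
    0 < r ∧ r < R ∧
    (∀ i j, i ≠ j → Disjoint (tube ρ (γ i) r) (tube ρ (γ j) r)) ∧
    (∀ i, IsFootDifferential (γ i) (F i) (tube ρ (γ i) R) (ds i)) ∧
    -- good representatives of the functionals of the faces
    (∀ S, IsFace P S → Represents (η S) (lam S) ∧
      ∀ i, ∀ x ∈ tube ρ (γ i) r, η S x = lam S (V.cls i) • ds i x) ∧
    -- the square of the dual norm of `ds i` on the tube has its maximum `1 / εᵢ²` exactly on the
    -- curve
    (∀ i, (∀ t, dualSq g (γ i t) (ds i (γ i t)) = 1 / V.eps i ^ 2) ∧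
      ∀ x ∈ tube ρ (γ i) r \ Set.range (γ i), dualSq g x (ds i x) < 1 / V.eps i ^ 2) ∧
    -- the dual norm of the good representatives is at most `1` outside of the tubes
    (∀ S, IsFace P S → ∀ x, (∀ i, x ∉ tube ρ (γ i) r) → dualSq g x (η S x) ≤ 1)

/-! ### The abelian covering -/

section Cover

variable {Mbar : Type v} [TopologicalSpace Mbar] [ChartedSpace (EuclideanSpace ℝ (Fin n)) Mbar]

variable (n) in
/-- `p : Mbar → M` is the abelian covering of `M`: the connected smooth normal covering with group
of deck transformations `H₁(M; ℤ)_ℝ`, where the deck transformation of `v` moves `x` to the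
endpoint of the lifts starting at `x` of the loops of class `v`. Equivalently, it is the covering
associated with the kernel of `π₁(M) → H₁(M; ℝ)`, with the action of
`π₁(M) / ker = H₁(M; ℤ)_ℝ`. -/
structure IsAbelianCover [AddAction (integerClasses M) Mbar] (p : Mbar → M) : Prop where
  connected : ConnectedSpace Mbar
  isLocalDiffeomorph : IsLocalDiffeomorph (𝓡 n) (𝓡 n) ∞ p
  isCovering : IsAddQuotientCoveringMap p (integerClasses M)
  hasClass : ∀ (v : integerClasses M) (c : C(unitInterval, Mbar)),
    c 1 = v +ᵥ c 0 → HasClass (fun t => p (c t)) (v : H1 M)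

/-- The distance on `Mbar` of the pull-back metric `p^* g` (the infimum of the lengths of `C¹` paths
for the norms `X ↦ √(g (dp X, dp X))` on the tangent spaces). -/
def liftedEDist (g : Metric n M) (p : Mbar → M) (x y : Mbar) : ℝ≥0∞ :=
  letI : ∀ z : Mbar, ENorm (TangentSpace (𝓡 n) z) := fun z =>
    ⟨fun X => ENNReal.ofReal (√(g.inner (p z) (mfderiv (𝓡 n) (𝓡 n) p z X)
      (mfderiv (𝓡 n) (𝓡 n) p z X)))⟩
  Manifold.riemannianEDist (𝓡 n) x y

end Cover

end Geometry

end Hedlund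

end

noncomputable section

namespace Hedlund

open Set MeasureTheory

/-! ### Homology classes of closed curves -/

section Homology

/-! An element of the monoid is `w = ∑ kⱼ (±vⱼ)` over the vertices in `S`, and `λ_S` takes the value
`εⱼ` on each of these classes, so `λ_S(w) = ∑ kⱼ εⱼ`. It thus suffices to realize `kⱼ` copies of
`±vⱼ` at cost `kⱼ εⱼ` plus a constant.

The curve `Γⱼ` has length at most `εⱼ` (`inner_velocity_le`): `dsⱼ` is `1` on the velocity and kills
normal vectors, so its dual norm, which is `1/εⱼ`, is at most the inverse of the speed. From any
point of the cover, walk to a lift of `Γⱼ` at cost at most `D`, follow it `kⱼ` times, and return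
along the translate of the way out (`liftedEDist_nsmul_vadd_le`); here `D` bounds the lengths needed
to join two points of `M` (`exists_curveLength_le`). The detour `2D` is paid once per vertex class,
hence at most `2N` times, whatever `w` is. -/

lemma HasClass.unique {M : Type u} [TopologicalSpace M] {c : unitInterval → M} {h h' : H1 M}
    (hh : HasClass c h) (hh' : HasClass c h') : h = h' := by
  obtain ⟨hc, -, z, hz, rfl⟩ := hh
  obtain ⟨hc', -, z', hz', rfl⟩ := hh'
  -- The inclusion of cycles into chains is mono, so the chain of the curve determines its cycle.
  have hinj : Function.Injective (cycleChain M) :=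
    (ModuleCat.mono_iff_injective ((singularChains M).iCycles 1)).1 inferInstance
  rw [hinj (hz.trans hz'.symm)]

end Homology

/-! ### Regularity of lifted curves -/

section LocalDiffeo

variable {n : ℕ} {M : Type u} [TopologicalSpace M] [ChartedSpace (EuclideanSpace ℝ (Fin n)) M]
  {Mbar : Type v} [TopologicalSpace Mbar] [ChartedSpace (EuclideanSpace ℝ (Fin n)) Mbar]

/-- Near each parameter, continuity keeps `c` where a local inverse of `p` undoes `p`, so `c` is
that inverse composed with `p ∘ c`. -/
lemma contMDiffOn_of_comp_isLocalDiffeomorph {p : Mbar → M}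
    (hp : IsLocalDiffeomorph (𝓡 n) (𝓡 n) ∞ p) {c : ℝ → Mbar} {s : Set ℝ}
    (hc : ContinuousOn c s) (hpc : ContMDiffOn 𝓘(ℝ, ℝ) (𝓡 n) 1 (p ∘ c) s) :
    ContMDiffOn 𝓘(ℝ, ℝ) (𝓡 n) 1 c s := by
  intro t ht
  have h1 : ContMDiffAt (𝓡 n) (𝓡 n) 1 (hp (c t)).localInverse ((p ∘ c) t) :=
    (hp (c t)).localInverse_contMDiffAt.of_le (by norm_num)
  have h2 := h1.comp_contMDiffWithinAt t (hpc t ht)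
  refine h2.congr_of_eventuallyEq ?_ ((hp (c t)).localInverse_left_inv
    (hp (c t)).localInverse_mem_target).symm
  filter_upwards [(hc t ht).eventually (hp (c t)).localInverse_eventuallyEq_left] with s hs
  exact hs.symm

end LocalDiffeo

/-! ### Lengths, the lifted distance and lifts of curves -/

section Length

variable {n : ℕ} {M : Type u} [TopologicalSpace M] [ChartedSpace (EuclideanSpace ℝ (Fin n)) M]
  [IsManifold (𝓡 n) ∞ M]

/-- The length of a tangent vector for the metric `g`. -/
def metricNorm (g : Metric n M) {x : M} (X : TangentSpace (𝓡 n) x) : ℝ≥0∞ :=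
  ENNReal.ofReal (√(g.inner x X X))

lemma metricNorm_smul (g : Metric n M) {x : M} (a : ℝ) (X : TangentSpace (𝓡 n) x) :
    metricNorm g (a • X) = ‖a‖ₑ * metricNorm g X := by
  have : g.inner x (a • X) (a • X) = a ^ 2 * g.inner x X X := by
    rw [map_smul, map_smul, smul_apply, smul_eq_mul, smul_eq_mul]; ring
  rw [metricNorm, this, Real.sqrt_mul (sq_nonneg a), Real.sqrt_sq_eq_abs,
    ENNReal.ofReal_mul (abs_nonneg a), metricNorm, ← Real.norm_eq_abs, ofReal_norm]

/-- The length of a curve for the metric `g`. -/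
def curveLength (g : Metric n M) (c : ℝ → M) : ℝ≥0∞ :=
  ∫⁻ t in Icc (0 : ℝ) 1, metricNorm g (velocity c t)

variable {Mbar : Type v} [TopologicalSpace Mbar] [ChartedSpace (EuclideanSpace ℝ (Fin n)) Mbar]

/-- The norms on the tangent spaces of the source induced by a map and a metric on the target. -/
@[reducible] def liftedENorm (g : Metric n M) (p : Mbar → M) (z : Mbar) :
    ENorm (TangentSpace (𝓡 n) z) :=
  ⟨fun X => metricNorm g (mfderiv (𝓡 n) (𝓡 n) p z X)⟩

/-- Homogeneity is what makes length invariant under reparametrization, hence gives symmetry and the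
triangle inequality below. -/
lemma liftedENorm_smulClass (g : Metric n M) (p : Mbar → M) (z : Mbar) :
    @ENormSMulClass ℝ (TangentSpace (𝓡 n) z) _ (liftedENorm g p z) _ := by
  let := liftedENorm g p z
  refine ⟨fun a X => ?_⟩
  change metricNorm g (mfderiv (𝓡 n) (𝓡 n) p z (a • X)) = _
  rw [map_smul]
  exact metricNorm_smul g a _

lemma liftedEDist_comm (g : Metric n M) (p : Mbar → M) (x y : Mbar) :
    liftedEDist g p x y = liftedEDist g p y x := by
  let := liftedENorm g p
  have : ∀ z : Mbar, ENormSMulClass ℝ (TangentSpace (𝓡 n) z) := liftedENorm_smulClass g p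
  exact Manifold.riemannianEDist_comm (I := 𝓡 n) (x := x) (y := y)

lemma liftedEDist_self (g : Metric n M) (p : Mbar → M) (x : Mbar) :
    liftedEDist g p x x = 0 := by
  let := liftedENorm g p
  have : ∀ z : Mbar, ENormSMulClass ℝ (TangentSpace (𝓡 n) z) := liftedENorm_smulClass g p
  exact Manifold.riemannianEDist_self (I := 𝓡 n) (x := x)

lemma liftedEDist_triangle (g : Metric n M) (p : Mbar → M) (x y z : Mbar) :
    liftedEDist g p x z ≤ liftedEDist g p x y + liftedEDist g p y z := by
  let := liftedENorm g p
  have : ∀ z : Mbar, ENormSMulClass ℝ (TangentSpace (𝓡 n) z) := liftedENorm_smulClass g p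
  have := Manifold.riemannianEDist_triangle (I := 𝓡 n) (x := x) (y := y) (z := z)
  exact this

lemma pathELength_liftedENorm (g : Metric n M) {p : Mbar → M}
    (hp : IsLocalDiffeomorph (𝓡 n) (𝓡 n) ∞ p) {c : ℝ → Mbar}
    (hc : ContMDiffOn 𝓘(ℝ, ℝ) (𝓡 n) 1 c (Icc 0 1)) :
    @Manifold.pathELength _ _ _ _ _ (𝓡 n) Mbar _ _ (liftedENorm g p) c 0 1 =
      curveLength g (p ∘ c) := by
  let := liftedENorm g p
  -- Endpoints are discarded: `c` is regular only within `Icc 0 1`, so the chain rule for `mfderiv`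
  -- is used in the interior.
  rw [Manifold.pathELength_eq_lintegral_mfderiv_Ioo, curveLength,
    ← restrict_Ioo_eq_restrict_Icc]
  refine setLIntegral_congr_fun measurableSet_Ioo fun t ht => ?_
  have h1 : MDifferentiableAt 𝓘(ℝ, ℝ) (𝓡 n) c t :=
    ((hc t (Ioo_subset_Icc_self ht)).contMDiffAt (Icc_mem_nhds ht.1 ht.2)).mdifferentiableAt
      one_ne_zero
  have h2 := (hp (c t)).mdifferentiableAt (by simp)
  change metricNorm g (mfderiv (𝓡 n) (𝓡 n) p (c t) (mfderiv 𝓘(ℝ, ℝ) (𝓡 n) c t 1)) =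
    metricNorm g (velocity (p ∘ c) t)
  rw [velocity, mfderiv_comp t h2 h1]
  rfl

lemma liftedEDist_le_curveLength (g : Metric n M) {p : Mbar → M}
    (hp : IsLocalDiffeomorph (𝓡 n) (𝓡 n) ∞ p) {c : ℝ → Mbar} (hc : ContinuousOn c (Icc 0 1))
    (hpc : ContMDiffOn 𝓘(ℝ, ℝ) (𝓡 n) 1 (p ∘ c) (Icc 0 1)) :
    liftedEDist g p (c 0) (c 1) ≤ curveLength g (p ∘ c) := by
  have hc' := contMDiffOn_of_comp_isLocalDiffeomorph hp hc hpc
  rw [← pathELength_liftedENorm g hp hc']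
  let := liftedENorm g p
  have : ∀ z : Mbar, ENormSMulClass ℝ (TangentSpace (𝓡 n) z) := liftedENorm_smulClass g p
  have := Manifold.riemannianEDist_le_pathELength (I := 𝓡 n) (x := c 0) (y := c 1) hc' rfl rfl
    zero_le_one
  exact this

variable [AddAction (integerClasses M) Mbar] {p : Mbar → M}

omit [IsManifold (𝓡 n) ∞ M] in
lemma IsAbelianCover.apply_vadd (hp : IsAbelianCover n p) (v : integerClasses M) (x : Mbar) :
    p (v +ᵥ x) = p x :=
  hp.isCovering.apply_eq_iff_mem_orbit.2 ⟨v, rfl⟩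

/-- A curve and its translate have the same projection, hence the same length. -/
lemma IsAbelianCover.liftedEDist_vadd_le (hp : IsAbelianCover n p) (g : Metric n M)
    (v : integerClasses M) (x y : Mbar) :
    liftedEDist g p (v +ᵥ x) (v +ᵥ y) ≤ liftedEDist g p x y := by
  refine le_of_forall_gt fun r hr => ?_
  obtain ⟨c, rfl, rfl, hc, hlen⟩ :
      ∃ c : ℝ → Mbar, c 0 = x ∧ c 1 = y ∧ ContMDiffOn 𝓘(ℝ, ℝ) (𝓡 n) 1 c (Icc 0 1) ∧
        @Manifold.pathELength _ _ _ _ _ (𝓡 n) Mbar _ _ (liftedENorm g p) c 0 1 < r := by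
    let := liftedENorm g p
    exact Manifold.exists_lt_of_riemannianEDist_lt hr
  rw [pathELength_liftedENorm g hp.isLocalDiffeomorph hc] at hlen
  have hpc : p ∘ (fun t => v +ᵥ c t) = p ∘ c := funext fun t => hp.apply_vadd v (c t)
  -- Continuity of the action is enough: the translate is `C¹` because its projection is.
  have hcont : ContinuousOn (fun t => v +ᵥ c t) (Icc 0 1) :=
    (hp.isCovering.continuous_const_vadd v).comp_continuousOn hc.continuousOn
  refine (liftedEDist_le_curveLength g hp.isLocalDiffeomorph hcont ?_).trans_lt (hpc ▸ hlen)
  rw [hpc]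
  exact (hp.isLocalDiffeomorph.contMDiff.of_le (by norm_num)).comp_contMDiffOn hc

lemma IsAbelianCover.exists_lift (hp : IsAbelianCover n p) (g : Metric n M) {c : ℝ → M}
    (hc : ContMDiffOn 𝓘(ℝ, ℝ) (𝓡 n) 1 c (Icc 0 1)) {x : Mbar} (hx : p x = c 0) :
    ∃ Γ : C(unitInterval, Mbar), (∀ t, p (Γ t) = c t) ∧ Γ 0 = x ∧
      liftedEDist g p x (Γ 1) ≤ curveLength g c := by
  let γ : C(unitInterval, M) := ⟨fun t => c t, hc.continuousOn.comp_continuous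
    continuous_subtype_val fun t => t.2⟩
  obtain ⟨Γ, hΓ, h0⟩ := hp.isCovering.isCoveringMap.exists_path_lifts γ x hx.symm
  refine ⟨Γ, fun t => congrFun hΓ t, h0, ?_⟩
  -- The lift is extended by constants outside `[0,1]`; `p ∘ cb` agrees with `c` only on that
  -- interval, so velocities are compared in its interior.
  let cb : ℝ → Mbar := fun t => Γ (projIcc 0 1 zero_le_one t)
  have hcb : Continuous cb := Γ.continuous.comp continuous_projIcc
  have hpcb : EqOn (p ∘ cb) c (Icc 0 1) := fun t ht => by
    have := congrFun hΓ (projIcc 0 1 zero_le_one t)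
    simp only [Function.comp_apply, projIcc_of_mem zero_le_one ht] at this
    simpa [cb, γ, projIcc_of_mem zero_le_one ht] using this
  have h := liftedEDist_le_curveLength g hp.isLocalDiffeomorph hcb.continuousOn
    (hc.congr hpcb)
  have hlen : curveLength g (p ∘ cb) = curveLength g c := by
    rw [curveLength, curveLength, ← restrict_Ioo_eq_restrict_Icc]
    refine setLIntegral_congr_fun measurableSet_Ioo fun t ht => ?_
    have hev : p ∘ cb =ᶠ[𝓝 t] c := by
      filter_upwards [Icc_mem_nhds ht.1 ht.2] with s hs using hpcb hs
    simp only [velocity, metricNorm]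
    rw [hev.mfderiv_eq, hev.eq_of_nhds]
  rw [hlen] at h
  have e0 : cb 0 = x := by simpa [cb] using h0
  have e1 : cb 1 = Γ 1 := by simp [cb]
  rwa [e0, e1] at h

/-- The lift of a closed curve of class `v` ends at the translate by `v` of its origin. -/
lemma IsAbelianCover.liftedEDist_vadd_of_hasClass (hp : IsAbelianCover n p) (g : Metric n M)
    {c : ℝ → M} (hc : ContMDiffOn 𝓘(ℝ, ℝ) (𝓡 n) 1 c (Icc 0 1)) {v : integerClasses M}
    (hv : HasClass (fun t : unitInterval => c t) (v : H1 M)) {x : Mbar} (hx : p x = c 0) :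
    liftedEDist g p x (v +ᵥ x) ≤ curveLength g c := by
  obtain ⟨Γ, hΓ, h0, hlen⟩ := hp.exists_lift g hc hx
  -- The endpoint lies in the fibre of `x`, so it is `v' +ᵥ x`; the projected loop then has both
  -- classes `v'` and `v`, which must agree.
  have hend : p (Γ 1) = p x := by
    obtain ⟨-, h01, -⟩ := hv
    rw [hΓ, hx]
    simpa using h01.symm
  obtain ⟨v', hv'⟩ := hp.isCovering.apply_eq_iff_mem_orbit.1 hend
  have hv' : v' +ᵥ x = Γ 1 := hv'
  have hcl := hp.hasClass v' Γ (by rw [h0, hv'])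
  simp only [hΓ] at hcl
  have : v' = v := Subtype.ext (hcl.unique hv)
  rwa [← hv', this] at hlen

end Length

/-! ### Finite diameter of a compact connected manifold -/

section Diameter

open scoped Bundle

variable {n : ℕ} {M : Type u} [TopologicalSpace M] [ChartedSpace (EuclideanSpace ℝ (Fin n)) M]
  [IsManifold (𝓡 n) ∞ M]

/-- Any two points of a compact connected manifold are joined by curves of bounded length. -/
lemma exists_curveLength_le [CompactSpace M] [ConnectedSpace M] (g : Metric n M) :
    ∃ D : ℝ≥0∞, D < ⊤ ∧ ∀ x y : M, ∃ c : ℝ → M, c 0 = x ∧ c 1 = y ∧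
      ContMDiffOn 𝓘(ℝ, ℝ) (𝓡 n) 1 c (Icc 0 1) ∧ curveLength g c < D := by
  let : Bundle.RiemannianBundle (fun x : M => TangentSpace (𝓡 n) x) := ⟨g.toRiemannianMetric⟩
  have : IsContMDiffRiemannianBundle (𝓡 n) ∞ (EuclideanSpace ℝ (Fin n))
    (fun x : M => TangentSpace (𝓡 n) x) := ⟨g.inner, g.contMDiff, fun _ _ _ => rfl⟩
  have : IsContinuousRiemannianBundle (EuclideanSpace ℝ (Fin n))
    (fun x : M => TangentSpace (𝓡 n) x) :=
      ⟨g.inner, g.contMDiff.continuous, fun _ _ _ => rfl⟩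
  have : IsManifold (𝓡 n) 1 M := .of_le (n := ∞) (by norm_num)
  let d : M → M → ℝ≥0∞ := Manifold.riemannianEDist (𝓡 n)
  have hnorm (x : M) (X : TangentSpace (𝓡 n) x) : ‖X‖ₑ = metricNorm g X := by
    rw [metricNorm, ← ofReal_norm, norm_eq_sqrt_real_inner]
    rfl
  have near (x : M) {r : ℝ≥0∞} (hr : 0 < r) : ∀ᶠ y in 𝓝 x, d x y < r :=
    eventually_riemannianEDist_lt (𝓡 n) x hr
  have comm (x y : M) : d x y = d y x := Manifold.riemannianEDist_comm
  have tri (x y z : M) : d x z ≤ d x y + d y z := Manifold.riemannianEDist_triangle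
  -- Points at finite distance from `x` form a clopen set, since every point has a neighborhood at
  -- finite distance; connectedness concludes.
  have hfin (x y : M) : d x y < ⊤ := by
    have hcl : IsClopen {y | d x y < ⊤} := by
      constructor
      · rw [← isOpen_compl_iff, isOpen_iff_mem_nhds]
        intro y hy
        filter_upwards [near y ENNReal.zero_lt_top] with z hz hxz
        exact hy ((tri x z y).trans_lt (ENNReal.add_lt_top.2 ⟨hxz, comm y z ▸ hz⟩))
      · rw [isOpen_iff_mem_nhds]
        intro y hy
        filter_upwards [near y ENNReal.zero_lt_top] with z hz
        exact (tri x y z).trans_lt (ENNReal.add_lt_top.2 ⟨hy, hz⟩)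
    have := hcl.eq_univ ⟨x, by
      have : d x x = 0 := Manifold.riemannianEDist_self
      simp [this]⟩
    exact this.symm.subset (mem_univ y)
  obtain ⟨t, -, ht⟩ := isCompact_univ.elim_nhds_subcover (fun x : M => {y | d x y < 1})
    fun x _ => near x one_pos
  -- The sum over all pairs of centers serves as an upper bound for their mutual distances; the two
  -- `1`s added next are the unit balls at both ends.
  let D : ℝ≥0∞ := ∑ x ∈ t, ∑ y ∈ t, d x y
  refine ⟨1 + D + 1, ?_, fun x y => ?_⟩
  · simp only [ENNReal.add_lt_top, ENNReal.one_lt_top, true_and, and_true, D, ENNReal.sum_lt_top]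
    exact fun x _ y _ => hfin x y
  · obtain ⟨a, ha, hax⟩ := mem_iUnion₂.1 (ht (mem_univ x))
    obtain ⟨b, hb, hby⟩ := mem_iUnion₂.1 (ht (mem_univ y))
    have hab : d a b ≤ D := (Finset.single_le_sum (f := fun y => d a y) (fun _ _ => zero_le) hb).trans
      (Finset.single_le_sum (f := fun x => ∑ y ∈ t, d x y) (fun _ _ => zero_le) ha)
    have hax : d x a < 1 := comm a x ▸ hax
    have hxy : d x y < 1 + D + 1 :=
      calc d x y ≤ d x b + d b y := tri x b y
        _ ≤ (d x a + d a b) + d b y := by gcongr; exact tri x a b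
        _ < 1 + D + 1 := ENNReal.add_lt_add (ENNReal.add_lt_add_of_lt_of_le (hfin _ _).ne hax hab) hby
    obtain ⟨c, h0, h1, hc, hlen⟩ := Manifold.exists_lt_of_riemannianEDist_lt hxy
    refine ⟨c, h0, h1, hc, ?_⟩
    rw [Manifold.pathELength_eq_lintegral_mfderiv_Icc] at hlen
    refine lt_of_eq_of_lt ?_ hlen
    refine lintegral_congr fun t => (hnorm _ _).symm

end Diameter

/-! ### The foot-point form and the speed of the Hedlund curves -/

section Speed

variable {n : ℕ} {M : Type u} [TopologicalSpace M] [ChartedSpace (EuclideanSpace ℝ (Fin n)) M]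

lemma velocity_comp_mul {c : ℝ → M} (a t : ℝ) (hc : MDifferentiableAt 𝓘(ℝ, ℝ) (𝓡 n) c (a * t)) :
    velocity (n := n) (fun τ => c (a * τ)) t = a • velocity (n := n) c (a * t) := by
  have h1 : HasMFDerivAt 𝓘(ℝ, ℝ) 𝓘(ℝ, ℝ) (fun τ : ℝ => a * τ) t
      (a • ContinuousLinearMap.id ℝ ℝ) :=
    ((hasFDerivAt_id t).const_mul a).hasMFDerivAt
  have h2 := (hc.hasMFDerivAt.comp t h1).mfderiv
  change mfderiv 𝓘(ℝ, ℝ) (𝓡 n) (c ∘ fun τ => a * τ) t 1 = _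
  rw [h2]
  exact map_smul (mfderiv 𝓘(ℝ, ℝ) (𝓡 n) c (a * t)) a (1 : TangentSpace 𝓘(ℝ, ℝ) (a * t))

variable [IsManifold (𝓡 n) ∞ M]

lemma chartMetric_smul_left (ρ : Metric n M) (x₀ : M) (y : EuclideanSpace ℝ (Fin n)) (a : ℝ)
    (v w : EuclideanSpace ℝ (Fin n)) :
    chartMetric ρ x₀ y (a • v) w = a * chartMetric ρ x₀ y v w := by
  rw [chartMetric, map_smul, map_smul, smul_apply, smul_eq_mul, chartMetric]

lemma chartMetric_smul_right (ρ : Metric n M) (x₀ : M) (y : EuclideanSpace ℝ (Fin n)) (a : ℝ)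
    (v w : EuclideanSpace ℝ (Fin n)) :
    chartMetric ρ x₀ y v (a • w) = a * chartMetric ρ x₀ y v w := by
  rw [chartMetric, map_smul, map_smul, smul_eq_mul, chartMetric]

/-- Both sides of the Euler-Lagrange equation scale by `a²`: on the left once through the velocity
and once through `d/dτ`, on the right through the quadratic dependence on the velocity. -/
lemma IsGeodesic.comp_mul {ρ : Metric n M} {c : ℝ → M} (hc : IsGeodesic ρ c) (a : ℝ) :
    IsGeodesic ρ fun t => c (a * t) := by
  refine ⟨hc.1.comp (contDiff_const.mul contDiff_id).contMDiff, ?_⟩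
  rintro t q rfl w
  let q : ℝ → EuclideanSpace ℝ (Fin n) := fun τ => extChartAt (𝓡 n) (c (a * t)) (c τ)
  have hq := hc.2 (a * t) q rfl w
  have hd (τ : ℝ) : deriv (fun τ => q (a * τ)) τ = a • deriv q (a * τ) := deriv_comp_mul_left a q τ
  change HasDerivAt (fun τ => chartMetric ρ (c (a * t)) (q (a * τ))
    (deriv (fun τ => q (a * τ)) τ) w) (1 / 2 * fderiv ℝ (fun y => chartMetric ρ (c (a * t)) y
      (deriv (fun τ => q (a * τ)) t) (deriv (fun τ => q (a * τ)) t)) (q (a * t)) w) t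
  simp only [hd, chartMetric_smul_left, chartMetric_smul_right]
  have h1 := ((hq.comp t ((hasDerivAt_id t).const_mul a)).const_mul a)
  convert! h1 using 1
  have e : (fun y => a * (a * chartMetric ρ (c (a * t)) y (deriv q (a * t)) (deriv q (a * t)))) =
      (a * a) • fun y => chartMetric ρ (c (a * t)) y (deriv q (a * t)) (deriv q (a * t)) := by
    ext y; simp [mul_assoc]
  rw [e, fderiv_const_smul_field, Pi.smul_apply, smul_apply, smul_eq_mul]
  ring

lemma IsGeodesic.isExp {ρ : Metric n M} {c : ℝ → M} (hc : IsGeodesic ρ c) (a : ℝ) :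
    IsExp ρ ⟨c 0, a • velocity c 0⟩ (c a) := by
  refine ⟨fun t => c (a * t), hc.comp_mul a, ?_, by simp⟩
  rw [velocity_comp_mul a 0 (hc.1.mdifferentiableAt (by simp))]
  -- The point `a * 0` is generalized to `s` so that the tangent spaces can be identified by
  -- substitution.
  have (s : ℝ) (hs : s = 0) :
      (⟨c s, a • velocity c s⟩ : TangentBundle (𝓡 n) M) = ⟨c 0, a • velocity c 0⟩ := by
    subst hs
    rfl
  exact this _ (mul_zero a)

/-- The vectors `a • X` remain in the normal ball, so the foot point is constant along the geodesic
ray issued from `X`. -/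
lemma IsTubular.exists_normal_ray {ρ : Metric n M} {γ : ℝ → M} {R : ℝ}
    {F : M → TangentBundle (𝓡 n) M} (hF : IsTubular ρ γ R F) {t : ℝ}
    {X : TangentSpace (𝓡 n) (γ t)} (hX : ρ.inner (γ t) X (velocity γ t) = 0)
    (hXR : ρ.inner (γ t) X X < R ^ 2) :
    ∃ c : ℝ → M, IsGeodesic ρ c ∧ (⟨c 0, velocity c 0⟩ : TangentBundle (𝓡 n) M) = ⟨γ t, X⟩ ∧
      ∀ a ∈ Icc (0 : ℝ) 1, c a ∈ tube ρ γ R ∧ (F (c a)).proj = γ t := by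
  obtain ⟨-, c, hc, h0, -⟩ := hF.exists_exp ⟨γ t, X⟩ ⟨t, X, hX, hXR, rfl⟩
  refine ⟨c, hc, h0, fun a ha => ?_⟩
  have hs (ξ : TangentBundle (𝓡 n) M) (h : (⟨c 0, velocity c 0⟩ : TangentBundle (𝓡 n) M) = ξ) :
      IsExp ρ ⟨ξ.1, a • ξ.2⟩ (c a) := by
    subst h
    exact hc.isExp a
  have hexp : IsExp ρ ⟨γ t, a • X⟩ (c a) := hs _ h0
  have hmem : (⟨γ t, a • X⟩ : TangentBundle (𝓡 n) M) ∈ normalBalls ρ γ R := by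
    refine ⟨t, a • X, by rw [map_smul, smul_apply, hX, smul_zero], ?_, rfl⟩
    rw [map_smul, map_smul, smul_apply, smul_eq_mul, smul_eq_mul, ← mul_assoc]
    have hpos : 0 ≤ ρ.inner (γ t) X X := by
      rcases eq_or_ne X 0 with rfl | h
      · simp
      · exact (ρ.pos _ X h).le
    nlinarith [mul_le_one₀ ha.2 ha.1 ha.2]
  exact ⟨⟨_, hmem, hexp⟩, by rw [hF.inverse _ hmem _ hexp]⟩

lemma IsTubular.mem_tube {ρ : Metric n M} {γ : ℝ → M} {R : ℝ}
    {F : M → TangentBundle (𝓡 n) M} (hF : IsTubular ρ γ R F) (t : ℝ) :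
    γ t ∈ tube ρ γ R ∧ (F (γ t)).proj = γ t := by
  obtain ⟨c, -, h0, h⟩ := hF.exists_normal_ray (t := t) (X := 0) (by simp)
    (by simpa using pow_pos hF.pos 2)
  have : c 0 = γ t := congrArg Bundle.TotalSpace.proj h0
  simpa [this] using h 0 (by simp)

omit [IsManifold (𝓡 n) ∞ M] in
-- Along `c`, a local lift `s` of the foot parameter and `l` differ by integers because `γ` is
-- simple; by continuity the integer is constant, so the derivatives agree. A one-sided neighborhood
-- suffices, and is all that normal rays provide.
lemma IsFootDifferential.apply_velocity {γ : ℝ → M}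
    (hγ : ∀ s t, γ s = γ t → ∃ k : ℤ, s = t + k) {F : M → TangentBundle (𝓡 n) M} {U : Set M}
    {ds : OneForm n M} (hds : IsFootDifferential γ F U ds) {c : ℝ → M} {t : ℝ}
    (hc : MDifferentiableAt 𝓘(ℝ, ℝ) (𝓡 n) c t) (hU : c t ∈ U) {l : ℝ → ℝ} {b : ℝ}
    (hl : HasDerivAt l b t) (hfoot : ∀ᶠ τ in 𝓝[≥] t, (F (c τ)).proj = γ (l τ)) :
    ds (c t) (velocity c t) = b := by
  obtain ⟨s, -, hs, hds⟩ := hds _ hU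
  have hderiv : HasDerivAt (s ∘ c) (ds (c t) (velocity c t)) t := by
    let L : ℝ →L[ℝ] ℝ := (ds (c t)).comp (mfderiv 𝓘(ℝ, ℝ) (𝓡 n) c t)
    have : HasFDerivAt (s ∘ c) L t := (hds.comp t hc.hasMFDerivAt).hasFDerivAt
    exact this.hasDerivAt
  have hint : ∀ᶠ τ in 𝓝[≥] t, ∃ k : ℤ, s (c τ) = l τ + k := by
    have hs' := (hc.continuousAt.eventually hs).filter_mono (nhdsWithin_le_nhds (s := Ici t))
    filter_upwards [hfoot, hs'] with τ h1 h2
    exact hγ _ _ (h2.trans h1)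
  have hd := (hderiv.sub hl).hasDerivWithinAt (s := Ici t)
  obtain ⟨k₀, hk₀⟩ := hint.self_of_nhdsWithin self_mem_Ici
  have hconst : (s ∘ c - l) =ᶠ[𝓝[≥] t] fun _ => (k₀ : ℝ) := by
    have hnear : ∀ᶠ τ in 𝓝[≥] t, |(s ∘ c - l) τ - (s ∘ c - l) t| < 1 :=
      hd.continuousWithinAt.eventually (Metric.ball_mem_nhds _ one_pos)
    filter_upwards [hint, hnear] with τ ⟨k, hk⟩ h
    simp only [Pi.sub_apply, Function.comp_apply, hk, hk₀, add_sub_cancel_left] at h ⊢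
    have : |k - k₀| < 1 := by exact_mod_cast h
    rw [Int.abs_lt_one_iff, sub_eq_zero] at this
    rw [this]
  have h0 := (hasDerivWithinAt_const t (Ici t) (k₀ : ℝ)).congr_of_eventuallyEq_of_mem hconst
    self_mem_Ici
  have := (uniqueDiffOn_Ici t t self_mem_Ici).eq_deriv _ hd h0
  linarith

/-- A covector which is `1` on `v` and vanishes on the vectors normal to `v` has dual norm at most
`1 / |v|`. -/
lemma dualSq_le {ρ g : Metric n M} (hconf : IsConformal ρ g) {x : M} {v : TangentSpace (𝓡 n) x}
    (hv : v ≠ 0) {α : TangentSpace (𝓡 n) x →L[ℝ] ℝ} (hαv : α v = 1)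
    (hα : ∀ X, ρ.inner x X v = 0 → α X = 0) : dualSq g x α ≤ 1 / g.inner x v v := by
  obtain ⟨f, -, hf, hfg⟩ := hconf
  have hgv := g.pos x v hv
  refine csSup_le ⟨0, 0, by simp, by simp⟩ ?_
  rintro _ ⟨X, hX, rfl⟩
  -- `a • v` is the `g`-orthogonal projection of `X` on `v`. By conformality the remainder is also
  -- `ρ`-normal, so `α X = a`, and Pythagoras gives `a² |v|² ≤ |X|² ≤ 1`.
  set a := g.inner x X v / g.inner x v v with ha
  have hYv : g.inner x (X - a • v) v = 0 := by
    rw [map_sub, map_smul, sub_apply, smul_apply, smul_eq_mul, ha, div_mul_cancel₀ _ hgv.ne',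
      sub_self]
  have hαX : α X = a := by
    have := hα (X - a • v) ((mul_eq_zero.1 ((hfg _ _ _).symm.trans hYv)).resolve_left (hf x).ne')
    rw [map_sub, map_smul, hαv, smul_eq_mul, mul_one] at this
    linarith
  have hYY : 0 ≤ g.inner x (X - a • v) (X - a • v) := by
    rcases eq_or_ne (X - a • v) 0 with h | h
    · simp [h]
    · exact (g.pos _ _ h).le
  have hexp : g.inner x (X - a • v) (X - a • v) = g.inner x X X - a ^ 2 * g.inner x v v := by
    have h1 : g.inner x (X - a • v) (X - a • v) = g.inner x (X - a • v) X := by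
      rw [map_sub (g.inner x (X - a • v)), map_smul, hYv, smul_zero, sub_zero]
    have h2 : g.inner x X v = a * g.inner x v v := by rw [ha, div_mul_cancel₀ _ hgv.ne']
    rw [h1, map_sub, map_smul, sub_apply, smul_apply, smul_eq_mul, g.symm x v X, h2]
    ring
  rw [hαX, le_div_iff₀ hgv]
  linarith

lemma inner_velocity_le {ρ g : Metric n M} (hconf : IsConformal ρ g) {γ : ℝ → M}
    (hγ : IsAdmissibleLoop ρ γ) {R : ℝ} {F : M → TangentBundle (𝓡 n) M}
    (hF : IsTubular ρ γ R F) {ds : OneForm n M}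
    (hds : IsFootDifferential γ F (tube ρ γ R) ds) {ε t : ℝ} (hε : 0 < ε)
    (hdual : dualSq g (γ t) (ds (γ t)) = 1 / ε ^ 2) :
    g.inner (γ t) (velocity γ t) (velocity γ t) ≤ ε ^ 2 := by
  have hv := hγ.regular t
  have hgv := g.pos _ _ hv
  have hone : ds (γ t) (velocity γ t) = 1 :=
    hds.apply_velocity hγ.simple (hγ.smooth.mdifferentiableAt (by simp)) (hF.mem_tube t).1
      (hasDerivAt_id t) (.of_forall fun τ => (hF.mem_tube τ).2)
  have hsmall (X : TangentSpace (𝓡 n) (γ t)) (hX : ρ.inner (γ t) X (velocity γ t) = 0)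
      (hXR : ρ.inner (γ t) X X < R ^ 2) : ds (γ t) X = 0 := by
    obtain ⟨c, hc, h0, h⟩ := hF.exists_normal_ray hX hXR
    have hc0 : ds (c 0) (velocity c 0) = 0 := by
      refine hds.apply_velocity hγ.simple (hc.1.mdifferentiableAt (by simp)) (h 0 (by simp)).1
        (hasDerivAt_const 0 t) ?_
      filter_upwards [Icc_mem_nhdsGE (zero_lt_one' ℝ)] with a ha using (h a ha).2
    have := congrArg (fun ξ : TangentBundle (𝓡 n) M => ds ξ.1 ξ.2) h0
    exact this.symm.trans hc0
  -- By linearity the bound on the length of `X` is removed: some positive multiple of `X` lies in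
  -- the normal ball.
  have hzero (X : TangentSpace (𝓡 n) (γ t)) (hX : ρ.inner (γ t) X (velocity γ t) = 0) :
      ds (γ t) X = 0 := by
    have hlim : Filter.Tendsto (fun a : ℝ => a ^ 2 * ρ.inner (γ t) X X) (𝓝[>] 0) (𝓝 0) := by
      have : Continuous fun a : ℝ => a ^ 2 * ρ.inner (γ t) X X := by fun_prop
      simpa using (this.tendsto 0).mono_left nhdsWithin_le_nhds
    obtain ⟨a, ha, ha0⟩ := ((hlim.eventually_lt_const (pow_pos hF.pos 2)).and
      self_mem_nhdsWithin).exists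
    have := hsmall (a • X) (by rw [map_smul, smul_apply, hX, smul_zero])
      (by
        rw [map_smul, map_smul, smul_apply, smul_eq_mul, smul_eq_mul, ← mul_assoc, ← sq]
        exact ha)
    rw [map_smul, smul_eq_mul] at this
    exact (mul_eq_zero.1 this).resolve_left (ne_of_gt ha0)
  have := dualSq_le hconf hv hone hzero
  rw [hdual] at this
  exact (one_div_le_one_div (pow_pos hε 2) hgv).1 this

lemma curveLength_le (g : Metric n M) {c : ℝ → M} {ε : ℝ} (hε : 0 < ε)
    (h : ∀ t, g.inner (c t) (velocity c t) (velocity c t) ≤ ε ^ 2) :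
    curveLength g c ≤ ENNReal.ofReal ε := by
  calc curveLength g c ≤ ∫⁻ _ in Icc (0 : ℝ) 1, ENNReal.ofReal ε :=
        lintegral_mono fun t => ENNReal.ofReal_le_ofReal (Real.sqrt_le_iff.2 ⟨hε.le, h t⟩)
    _ = ENNReal.ofReal ε := by simp

end Speed

/-! ### Cost of translating by multiples and sums of classes -/

section Translation

variable {n : ℕ} {M : Type u} [TopologicalSpace M] [ChartedSpace (EuclideanSpace ℝ (Fin n)) M]
  [IsManifold (𝓡 n) ∞ M]
  {Mbar : Type v} [TopologicalSpace Mbar] [ChartedSpace (EuclideanSpace ℝ (Fin n)) Mbar]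
  [AddAction (integerClasses M) Mbar] {p : Mbar → M}

/-- Each turn ends at a translate of `x`, which again lies over `c 0`, so the next turn can start
there. -/
lemma IsAbelianCover.liftedEDist_nsmul_vadd_of_hasClass (hp : IsAbelianCover n p) (g : Metric n M)
    {c : ℝ → M} (hc : ContMDiffOn 𝓘(ℝ, ℝ) (𝓡 n) 1 c (Icc 0 1)) {v : integerClasses M}
    (hv : HasClass (fun t : unitInterval => c t) (v : H1 M)) (k : ℕ) {x : Mbar} (hx : p x = c 0) :
    liftedEDist g p x (k • v +ᵥ x) ≤ k * curveLength g c := by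
  induction k with
  | zero => simp [liftedEDist_self]
  | succ k ih =>
    have hstep := hp.liftedEDist_vadd_of_hasClass g hc hv ((hp.apply_vadd (k • v) x).trans hx)
    rw [vadd_vadd, ← succ_nsmul'] at hstep
    calc liftedEDist g p x ((k + 1) • v +ᵥ x) ≤ k * curveLength g c + curveLength g c :=
          (liftedEDist_triangle g p _ _ _).trans (add_le_add ih hstep)
      _ = (k + 1 : ℕ) * curveLength g c := by push_cast; ring

/-- Translation by a multiple of the class of a closed curve `c`, starting from any point, costs at
most the length of that multiple of `c` and twice the cost `D` of reaching a lift of `c`. -/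
lemma IsAbelianCover.liftedEDist_nsmul_vadd_le (hp : IsAbelianCover n p) (g : Metric n M)
    {D : ℝ≥0∞} (hD : ∀ x y : M, ∃ c : ℝ → M, c 0 = x ∧ c 1 = y ∧
      ContMDiffOn 𝓘(ℝ, ℝ) (𝓡 n) 1 c (Icc 0 1) ∧ curveLength g c < D)
    {c : ℝ → M} (hc : ContMDiffOn 𝓘(ℝ, ℝ) (𝓡 n) 1 c (Icc 0 1)) {v : integerClasses M}
    (hv : HasClass (fun t : unitInterval => c t) (v : H1 M)) (k : ℕ) (x : Mbar) :
    liftedEDist g p x (k • v +ᵥ x) ≤ k * curveLength g c + 2 * D := by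
  obtain ⟨e, he0, he1, he, hlen⟩ := hD (p x) (c 0)
  obtain ⟨Γ, hΓ, -, hle⟩ := hp.exists_lift g he he0.symm
  have hxy : liftedEDist g p x (Γ 1) ≤ D := hle.trans hlen.le
  have hy : p (Γ 1) = c 0 := by rw [hΓ, ← he1]; rfl
  -- The way back is the translate by `k • v` of the way out, reversed.
  have hback : liftedEDist g p (k • v +ᵥ Γ 1) (k • v +ᵥ x) ≤ D :=
    (hp.liftedEDist_vadd_le g _ _ _).trans ((liftedEDist_comm g p _ _).trans_le hxy)
  calc liftedEDist g p x (k • v +ᵥ x) ≤ D + (k * curveLength g c + D) :=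
        (liftedEDist_triangle g p _ (Γ 1) _).trans (add_le_add hxy
          ((liftedEDist_triangle g p _ (k • v +ᵥ Γ 1) _).trans (add_le_add
            (hp.liftedEDist_nsmul_vadd_of_hasClass g hc hv k hy) hback)))
    _ = k * curveLength g c + 2 * D := by ring

/-- Starting the bound at `-v +ᵥ x` and using symmetry replaces running the loop backwards. -/
lemma liftedEDist_neg_vadd_le (g : Metric n M) {v : integerClasses M} {b : ℝ≥0∞}
    (h : ∀ x : Mbar, liftedEDist g p x (v +ᵥ x) ≤ b) (x : Mbar) :
    liftedEDist g p x (-v +ᵥ x) ≤ b := by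
  have := h (-v +ᵥ x)
  rwa [vadd_vadd, add_neg_cancel, zero_vadd, liftedEDist_comm] at this

lemma liftedEDist_sum_vadd_le (g : Metric n M) {ι : Type*} (s : Finset ι)
    {v : ι → integerClasses M} {b : ι → ℝ≥0∞}
    (h : ∀ i ∈ s, ∀ x : Mbar, liftedEDist g p x (v i +ᵥ x) ≤ b i) (x : Mbar) :
    liftedEDist g p x ((∑ i ∈ s, v i) +ᵥ x) ≤ ∑ i ∈ s, b i := by
  classical
  induction s using Finset.induction_on with
  | empty => simp [liftedEDist_self]
  | insert i s hi ih =>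
    rw [Finset.sum_insert hi, Finset.sum_insert hi, add_vadd, add_comm (b i)]
    exact (liftedEDist_triangle g p _ _ _).trans (add_le_add
      (ih fun j hj => h j (Finset.mem_insert_of_mem hj)) (h i (Finset.mem_insert_self i s) _))

end Translation

/-! ### Signed vertices and their classes -/

section Vertices

variable {M : Type u} [TopologicalSpace M] {P : Set (H1 M)} {N : ℕ} (V : VertexClasses P N)

/-- The vertices `±ṽᵢ`. -/
def VertexClasses.signedVtx (j : Fin N × Bool) : H1 M := if j.2 then V.vtx j.1 else -V.vtx j.1

/-- The classes `±vᵢ`. -/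
def VertexClasses.signedCls (j : Fin N × Bool) : integerClasses M :=
  if j.2 then V.cls j.1 else -V.cls j.1

lemma VertexClasses.signedCls_eq (j : Fin N × Bool) :
    (V.signedCls j : H1 M) = V.eps j.1 • V.signedVtx j := by
  obtain ⟨i, _ | _⟩ := j <;> simp [signedCls, signedVtx, V.cls_eq]

lemma VertexClasses.signedVtx_mem (j : Fin N × Bool) : V.signedVtx j ∈ P.extremePoints ℝ := by
  rw [V.extremePoints_eq]
  obtain ⟨i, _ | _⟩ := j <;> simp [signedVtx]

/-- Exhibits `J_S` as a finite family, so that elements of the generated monoid become natural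
combinations with at most `2N` terms. -/
lemma VertexClasses.inFace_eq (S : Set (H1 M)) :
    V.inFace S = range fun j : {j // V.signedVtx j ∈ S} => V.signedCls j := by
  ext w
  simp [inFace, signedVtx, signedCls, eq_comm (a := w), or_comm]

lemma VertexClasses.apply_signedCls {S : Set (H1 M)} {l : H1 M →ₗ[ℝ] ℝ}
    (hl : IsFaceFunctional P S l) {j : Fin N × Bool} (hj : V.signedVtx j ∈ S) :
    l (V.signedCls j : H1 M) = V.eps j.1 := by
  rw [V.signedCls_eq, map_smul, (hl _ (V.signedVtx_mem j)).1 hj, smul_eq_mul, mul_one]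

end Vertices

/-! ### The estimate for a fixed cover -/

section Estimate

variable {n : ℕ} {M : Type u} [TopologicalSpace M] [ChartedSpace (EuclideanSpace ℝ (Fin n)) M]
  [IsManifold (𝓡 n) ∞ M]
  {Mbar : Type v} [TopologicalSpace Mbar] [ChartedSpace (EuclideanSpace ℝ (Fin n)) Mbar]
  [AddAction (integerClasses M) Mbar] {p : Mbar → M}
  {P : Set (H1 M)} {N : ℕ} {V : VertexClasses P N} {γ : Fin N → ℝ → M}

lemma IsAbelianCover.liftedEDist_closure_vadd_le (hp : IsAbelianCover n p) {g : Metric n M}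
    {D : ℝ≥0∞} (hDtop : D < ⊤) (hD : ∀ x y : M, ∃ c : ℝ → M, c 0 = x ∧ c 1 = y ∧
      ContMDiffOn 𝓘(ℝ, ℝ) (𝓡 n) 1 c (Icc 0 1) ∧ curveLength g c < D)
    (hγ : ∀ i, ContMDiffOn 𝓘(ℝ, ℝ) (𝓡 n) 1 (γ i) (Icc 0 1))
    (hcls : ∀ i, HasClass (fun t : unitInterval => γ i t) (V.cls i))
    (hlen : ∀ i, curveLength g (γ i) ≤ ENNReal.ofReal (V.eps i))
    {S : Set (H1 M)} {l : H1 M →ₗ[ℝ] ℝ} (hl : IsFaceFunctional P S l)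
    {w : integerClasses M} (hw : w ∈ AddSubmonoid.closure (V.inFace S)) (x : Mbar) :
    liftedEDist g p x (w +ᵥ x) ≤ ENNReal.ofReal (l (w : H1 M) + N * 2 * (2 * D).toReal) := by
  classical
  rw [V.inFace_eq] at hw
  obtain ⟨k, rfl⟩ := AddSubmonoid.exists_of_mem_closure_range _ _ hw
  -- All copies of one class are grouped, so the detour `2 * D` occurs once per vertex and not once
  -- per copy.
  have hstep (j : Fin N × Bool) (m : ℕ) (x : Mbar) : liftedEDist g p x (m • V.signedCls j +ᵥ x) ≤
      ENNReal.ofReal (m * V.eps j.1 + (2 * D).toReal) := by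
    have hb (i : Fin N) (x : Mbar) : liftedEDist g p x (m • V.cls i +ᵥ x) ≤
        ENNReal.ofReal (m * V.eps i + (2 * D).toReal) := by
      rw [ENNReal.ofReal_add (mul_nonneg m.cast_nonneg (V.eps_pos i).le) ENNReal.toReal_nonneg,
        ENNReal.ofReal_mul m.cast_nonneg, ENNReal.ofReal_natCast,
        ENNReal.ofReal_toReal (ENNReal.mul_ne_top (by simp) hDtop.ne)]
      refine (hp.liftedEDist_nsmul_vadd_le g hD (hγ i) (hcls i) m x).trans ?_
      gcongr
      exact hlen i
    obtain ⟨i, _ | _⟩ := j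
    · simpa [VertexClasses.signedCls] using liftedEDist_neg_vadd_le g (hb i) x
    · simpa [VertexClasses.signedCls] using hb i x
  refine (liftedEDist_sum_vadd_le g Finset.univ (fun j _ => hstep j.1 (k j)) x).trans ?_
  rw [← ENNReal.ofReal_sum_of_nonneg fun j _ => add_nonneg
    (mul_nonneg (Nat.cast_nonneg _) (V.eps_pos _).le) ENNReal.toReal_nonneg]
  refine ENNReal.ofReal_le_ofReal ?_
  rw [Finset.sum_add_distrib]
  refine add_le_add (le_of_eq ?_) ?_
  -- The main terms add up exactly to `l w`, because `l` is `eps` on each class of the face.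
  · rw [AddSubgroup.val_finsetSum, map_sum]
    refine Finset.sum_congr rfl fun j _ => ?_
    rw [AddSubgroup.coe_nsmul, map_nsmul, V.apply_signedCls hl j.2, nsmul_eq_mul]
  · rw [Finset.sum_const, nsmul_eq_mul, Finset.card_univ]
    refine mul_le_mul_of_nonneg_right ?_ ENNReal.toReal_nonneg
    have : Fintype.card {j // V.signedVtx j ∈ S} ≤ N * 2 := by
      simpa using Fintype.card_subtype_le fun j => V.signedVtx j ∈ S
    exact_mod_cast this

end Estimate

end Hedlund

end

theorem mainTheorem4 {n : ℕ} (_hn : 3 ≤ n)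
    {M : Type u} [TopologicalSpace M] [T2Space M] [CompactSpace M] [ConnectedSpace M]
    [ChartedSpace (EuclideanSpace ℝ (Fin n)) M] [IsManifold (𝓡 n) ∞ M]
    (ρ : Hedlund.Metric n M)
    (P : Set (Hedlund.H1 M)) (_hP : Hedlund.IsAdmissiblePolytope P)
    {N : ℕ} (V : Hedlund.VertexClasses P N)
    (lam : Set (Hedlund.H1 M) → (Hedlund.H1 M →ₗ[ℝ] ℝ))
    (_hlam : ∀ S, Hedlund.IsFace P S → Hedlund.IsFaceFunctional P S (lam S))
    (g : Hedlund.Metric n M) (_hg : Hedlund.IsHedlundMetric ρ V lam g) :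
    ∃ C : ℝ, ∀ (Mbar : Type v) [TopologicalSpace Mbar]
      [ChartedSpace (EuclideanSpace ℝ (Fin n)) Mbar] [IsManifold (𝓡 n) ∞ Mbar]
      [AddAction (Hedlund.integerClasses M) Mbar] (p : Mbar → M),
      Hedlund.IsAbelianCover n p →
      ∀ S, Hedlund.IsFace P S → ∀ w ∈ AddSubmonoid.closure (V.inFace S), ∀ x : Mbar,
        Hedlund.liftedEDist g p x (w +ᵥ x) ≤ ENNReal.ofReal (lam S (w : Hedlund.H1 M) + C) := by
  obtain ⟨hconf, γ, R, r, F, ds, η, hγ, hcls, -, hF, -, -, -, hds, -, hdual, -⟩ := _hg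
  obtain ⟨D, hDtop, hD⟩ := Hedlund.exists_curveLength_le g
  -- One round trip of cost `2 * D` for each of the at most `N * 2` vertices of a face; `D` comes
  -- from `(M, g)` alone.
  refine ⟨N * 2 * (2 * D).toReal, fun Mbar _ _ _ _ p hp S hS w hw x => ?_⟩
  refine hp.liftedEDist_closure_vadd_le hDtop hD
    (fun i => ((hγ i).smooth.of_le (by norm_num)).contMDiffOn) hcls (fun i => ?_) (_hlam S hS) hw x
  exact Hedlund.curveLength_le g (V.eps_pos i) fun t =>
    Hedlund.inner_velocity_le hconf (hγ i) (hF i) (hds i) (V.eps_pos i) ((hdual i).1 t)
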